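/- Let $\mathcal H$ be a complex Hilbert space with $2\le\dim\mathcal H<\infty$, let $\mathcal L(\mathcal H)_{++}$ be the set of positive definite (that is, invertible positive semidefinite) operators on $\mathcal H$, and let $\alpha\in\,]0,1[\,\cup\,]1,\infty[$ be a fixed real number. For $A,B\in\mathcal L(\mathcal H)_{++}$ set \[ D^{\flat}_{\alpha}(A\Vert B)=(\alpha-1)^{-1}\log\Bigl((\operatorname{tr}A)^{-1}\operatorname{tr}\exp\bigl(\alpha\log A+(1-\alpha)\log B\bigr)\Bigr). \] Let $\phi:\mathcal L(\mathcal H)_{++}\to\mathcal L(\mathcal H)_{++}$ be a bijection such that \[ D^{\flat}_{\alpha}(\phi(A)\Vert\phi(B))=D^{\flat}_{\alpha}(A\Vert B)\qquad\text{for all }A,B\in\mathcal L(\mathcal H)_{++}. \] Then there exist a real number $\lambda>0$ and an operator $U$ on $\mathcal H$ that is either unitary or antiunitary (a conjugate-linear isometric bijection, with $U^{*}=U^{-1}$) such that \[ \phi(A)=\lambda\,UAU^{*}\qquad\text{for all }A\in\mathcal L(\mathcal H)_{++}. \] -/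

import Mathlib

noncomputable section

/-- The set of positive definite operators on a complex Hilbert space `H`: by definition of
`IsStrictlyPositive`, those `A` with `0 ≤ A` in the Löwner order and `A` invertible. -/
abbrev PosDefOp (H : Type*) [NormedAddCommGroup H] [InnerProductSpace ℂ H] [CompleteSpace H] :
    Type _ :=
  {A : H →L[ℂ] H // IsStrictlyPositive A}

/-- The trace of an operator, as a real number (it is only used for self-adjoint operators on a
finite-dimensional space, whose trace is real). -/
def realTrace {H : Type*} [NormedAddCommGroup H] [InnerProductSpace ℂ H]
    (A : H →L[ℂ] H) : ℝ :=
  (LinearMap.trace ℂ H (A : H →ₗ[ℂ] H)).re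

/-- The Rényi type divergence
`(α - 1)⁻¹ log ((tr A)⁻¹ tr exp (α log A + (1 - α) log B))` of positive definite operators. -/
def flatDivergence {H : Type*} [NormedAddCommGroup H] [InnerProductSpace ℂ H] [CompleteSpace H]
    (α : ℝ) (A B : PosDefOp H) : ℝ :=
  (α - 1)⁻¹ * Real.log ((realTrace A.1)⁻¹ *
    realTrace (NormedSpace.exp (α • CFC.log A.1 + (1 - α) • CFC.log B.1)))

/-- The linear operator `U A U*` for an antiunitary operator `U`, that is, a conjugate-linear
isometric bijection of `H`. The adjoint `U*` of an antiunitary operator, determined by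
`⟪U x, y⟫ = ⟪U* y, x⟫`, is its inverse. -/
def antiunitaryConj {H : Type*} [NormedAddCommGroup H] [InnerProductSpace ℂ H]
    (U : H ≃ₛₗᵢ[starRingEnd ℂ] H) (A : H →L[ℂ] H) : H →L[ℂ] H :=
  (U : H →SL[starRingEnd ℂ] H).comp (A.comp (U.symm : H →SL[starRingEnd ℂ] H))

end

/-! Conjugating `φ` with the exponential gives a bijection `ψ` of the self-adjoint operators with
`tr exp (α ψ(a) + (1 - α) ψ(b)) = c(a) tr exp (α a + (1 - α) b)`, where `c(a) > 0` does not depend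
on `b`. The functions `X ↦ tr exp (X + A)` determine the Löwner order
(`le_iff_realTrace_exp_add_le`), so `ψ` respects order comparisons up to scalar shifts. These encode
the operator norm; hence `ψ` is a surjective isometry and, by Mazur–Ulam, `ψ(a) = L a + ψ(0)` with
`L` real linear. The map `L` also preserves positivity, so it permutes the projections, which are
the extreme points of the positive part of the unit ball. By the spectral theorem it preserves
squares. Its complexification is a Jordan `*`-automorphism, thus multiplicative or
antimultiplicative (Herstein), which gives the unitary or antiunitary operator. Finally, order
detection forces `ψ(0)` to be a scalar, and exponentiating gives `φ`. -/

noncomputable section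

open scoped InnerProductSpace

/-! ### Trace inequalities for the exponential, and detection of the order. -/

section TraceExp

variable {H : Type*} [NormedAddCommGroup H] [InnerProductSpace ℂ H]

theorem realTrace_eq_sum_inner {ι : Type*} [Fintype ι] (b : OrthonormalBasis ι ℂ H)
    (A : H →L[ℂ] H) : realTrace A = ∑ i, (⟪b i, A (b i)⟫_ℂ).re := by
  simp [realTrace, LinearMap.trace_eq_sum_inner _ b]

theorem realTrace_smul (r : ℝ) (A : H →L[ℂ] H) : realTrace (r • A) = r * realTrace A := by
  have : ((r • A : H →L[ℂ] H) : H →ₗ[ℂ] H) = (r : ℂ) • (A : H →ₗ[ℂ] H) := by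
    ext x; simp
  rw [realTrace, this, map_smul]
  simp [realTrace]

theorem re_inner_real_smul (v w : H) (r : ℝ) : (⟪v, r • w⟫_ℂ).re = r * (⟪v, w⟫_ℂ).re := by
  rw [inner_smul_right_eq_smul, Complex.smul_re, smul_eq_mul]

theorem re_inner_self_of_norm_eq_one {v : H} (hv : ‖v‖ = 1) : (⟪v, v⟫_ℂ).re = 1 := by
  simp [inner_self_eq_norm_sq_to_K, hv]

variable [CompleteSpace H]

theorem exp_apply_of_apply_eq_smul {A : H →L[ℂ] H} {v : H} {μ : ℝ} (h : A v = μ • v) :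
    NormedSpace.exp A v = Real.exp μ • v := by
  have hpow : ∀ n : ℕ, (A ^ n) v = μ ^ n • v := by
    intro n
    induction n with
    | zero => simp
    | succ n ih =>
      rw [pow_succ', mul_apply_eq_comp, ih, ContinuousLinearMap.map_smul_of_tower, h, smul_smul, pow_succ]
  have h1 : HasSum (fun n : ℕ => ((n.factorial : ℝ)⁻¹ • A ^ n) v) (NormedSpace.exp A v) :=
    (NormedSpace.exp_series_hasSum_exp' (𝕂 := ℝ) A).mapL (ContinuousLinearMap.apply ℂ H v)
  have h2 : HasSum (fun n : ℕ => ((n.factorial : ℝ)⁻¹ • μ ^ n) • v) (Real.exp μ • v) := by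
    rw [Real.exp_eq_exp_ℝ]
    exact (NormedSpace.exp_series_hasSum_exp' (𝕂 := ℝ) μ).smul_const v
  refine h1.unique (h2.congr_fun ?_)
  intro n
  simp [hpow, smul_smul]

theorem one_add_le_exp {A : H →L[ℂ] H} (hA : IsSelfAdjoint A) : 1 + A ≤ NormedSpace.exp A := by
  rw [← CFC.real_exp_eq_normedSpace_exp hA]
  conv_lhs => rw [← cfc_id ℝ A, ← cfc_one ℝ A, ← cfc_add ..]
  refine cfc_mono fun x _ => ?_
  simpa [add_comm] using Real.add_one_le_exp x

theorem exp_add_smul_one (A : H →L[ℂ] H) (c : ℝ) :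
    NormedSpace.exp (A + c • 1) = Real.exp c • NormedSpace.exp A := by
  let _ : NormedAlgebra ℚ (H →L[ℂ] H) := NormedAlgebra.restrictScalars ℚ ℂ _
  have hc : Commute A (c • (1 : H →L[ℂ] H)) := (Commute.one_right A).smul_right c
  have h1 : NormedSpace.exp (c • (1 : H →L[ℂ] H)) = Real.exp c • 1 := by
    ext v
    rw [exp_apply_of_apply_eq_smul (μ := c) (by simp)]
    simp
  rw [NormedSpace.exp_add_of_commute hc, h1, mul_smul_comm, mul_one]

/-- Jensen's inequality for a vector state: apply the tangent bound `1 + x ≤ exp x` to `A - m`, with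
`m` the expectation of `A` at `v`. -/
theorem exp_inner_le_inner_exp {A : H →L[ℂ] H} (hA : IsSelfAdjoint A) {v : H} (hv : ‖v‖ = 1) :
    Real.exp (⟪v, A v⟫_ℂ).re ≤ (⟪v, NormedSpace.exp A v⟫_ℂ).re := by
  set m := (⟪v, A v⟫_ℂ).re with hm
  have hself : IsSelfAdjoint (A + (-m) • 1) :=
    hA.add ((IsSelfAdjoint.all (-m)).smul (IsSelfAdjoint.one _))
  have h1 := one_add_le_exp hself
  rw [exp_add_smul_one, ContinuousLinearMap.le_def] at h1
  have h2 := h1.re_inner_nonneg_right v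
  have h3 : 1 ≤ Real.exp (-m) * (⟪v, NormedSpace.exp A v⟫_ℂ).re := by
    rw [RCLike.re_eq_complex_re] at h2
    simp only [_root_.sub_apply, _root_.add_apply, inner_sub_right,
      inner_add_right, _root_.smul_apply, one_apply_eq_self,
      Complex.sub_re, Complex.add_re, re_inner_real_smul, re_inner_self_of_norm_eq_one hv,
      ← hm] at h2
    linarith
  rw [Real.exp_neg] at h3
  have := Real.exp_pos m
  field_simp at h3
  exact h3

variable [FiniteDimensional ℂ H]

/-- The exponential is not operator monotone, but its trace is: in an eigenbasis of `A`, the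
diagonal of `B` dominates the eigenvalues of `A`, and Jensen applies to each diagonal entry. -/
theorem realTrace_exp_mono {A B : H →L[ℂ] H} (hA : IsSelfAdjoint A) (hB : IsSelfAdjoint B)
    (h : A ≤ B) : realTrace (NormedSpace.exp A) ≤ realTrace (NormedSpace.exp B) := by
  have hs : (A : H →ₗ[ℂ] H).IsSymmetric :=
    ContinuousLinearMap.isSelfAdjoint_iff_isSymmetric.mp hA
  let b := hs.eigenvectorBasis rfl
  rw [realTrace_eq_sum_inner b, realTrace_eq_sum_inner b]
  refine Finset.sum_le_sum fun i _ => ?_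
  have hb : ‖b i‖ = 1 := b.orthonormal.1 i
  have hAi : A (b i) = hs.eigenvalues rfl i • b i := by
    rw [RCLike.real_smul_eq_coe_smul (K := ℂ)]
    exact hs.apply_eigenvectorBasis rfl i
  have hle := (ContinuousLinearMap.le_def _ _).1 h |>.re_inner_nonneg_right (b i)
  rw [exp_apply_of_apply_eq_smul hAi]
  refine le_trans ?_ (exp_inner_le_inner_exp hB hb)
  rw [RCLike.re_eq_complex_re, _root_.sub_apply, hAi, inner_sub_right,
    Complex.sub_re, re_inner_real_smul, re_inner_self_of_norm_eq_one hb] at hle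
  rw [re_inner_real_smul, re_inner_self_of_norm_eq_one hb, mul_one]
  exact Real.exp_le_exp.2 (by linarith)

theorem inner_le_realTrace_exp {A : H →L[ℂ] H} (hA : IsSelfAdjoint A) {v : H} (hv : ‖v‖ = 1) :
    Real.exp (⟪v, A v⟫_ℂ).re ≤ realTrace (NormedSpace.exp A) := by
  classical
  have ho : Orthonormal ℂ ((↑) : ({v} : Set H) → H) := by
    rw [orthonormal_iff_ite]
    rintro ⟨x, rfl⟩ ⟨y, rfl⟩
    simp [inner_self_eq_norm_sq_to_K, hv]
  obtain ⟨u, b, hvu, hb⟩ := ho.exists_orthonormalBasis_extension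
  have hvu' : v ∈ u := by simpa using hvu
  rw [realTrace_eq_sum_inner b]
  have h1 : ∀ i, Real.exp (⟪b i, A (b i)⟫_ℂ).re ≤ (⟪b i, NormedSpace.exp A (b i)⟫_ℂ).re :=
    fun i => exp_inner_le_inner_exp hA (b.orthonormal.1 i)
  have h2 := Finset.single_le_sum
    (f := fun i => (⟪b i, NormedSpace.exp A (b i)⟫_ℂ).re)
    (fun i _ => (Real.exp_pos _).le.trans (h1 i)) (Finset.mem_univ (⟨v, hvu'⟩ : u))
  refine le_trans ?_ h2
  have := h1 ⟨v, hvu'⟩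
  simpa [hb] using this

theorem realTrace_exp_pos [Nontrivial H] {A : H →L[ℂ] H} (hA : IsSelfAdjoint A) :
    0 < realTrace (NormedSpace.exp A) := by
  obtain ⟨v, hv⟩ := exists_norm_eq H (zero_le_one (α := ℝ))
  exact (Real.exp_pos _).trans_le (inner_le_realTrace_exp hA hv)

theorem realTrace_exp_smul_rankOne {v : H} (hv : ‖v‖ = 1) (t : ℝ) :
    realTrace (NormedSpace.exp (t • InnerProductSpace.rankOne ℂ v v)) ≤
      Real.exp t + Module.finrank ℂ H := by
  classical
  have ho : Orthonormal ℂ ((↑) : ({v} : Set H) → H) := by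
    rw [orthonormal_iff_ite]
    rintro ⟨x, rfl⟩ ⟨y, rfl⟩
    simp [inner_self_eq_norm_sq_to_K, hv]
  obtain ⟨u, b, hvu, hb⟩ := ho.exists_orthonormalBasis_extension
  have hvu' : v ∈ u := by simpa using hvu
  have hcard : Module.finrank ℂ H = Fintype.card u := Module.finrank_eq_card_basis b.toBasis
  have hbv : b ⟨v, hvu'⟩ = v := by simp [hb]
  rw [realTrace_eq_sum_inner b, hcard]
  have key : ∀ i : u, (⟪b i, NormedSpace.exp (t • InnerProductSpace.rankOne ℂ v v) (b i)⟫_ℂ).re ≤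
      (if i = ⟨v, hvu'⟩ then Real.exp t else 0) + 1 := by
    intro i
    have hbb := re_inner_self_of_norm_eq_one (b.orthonormal.1 i)
    have hin : ⟪v, b i⟫_ℂ = if i = ⟨v, hvu'⟩ then 1 else 0 := by
      nth_rewrite 1 [← hbv]
      rw [orthonormal_iff_ite.1 b.orthonormal]
      simp [eq_comm]
    split_ifs with h
    · rw [exp_apply_of_apply_eq_smul (μ := t)]
      · rw [re_inner_real_smul, hbb, mul_one]
        exact le_add_of_nonneg_right zero_le_one
      · subst h
        simp [hbv, inner_self_eq_norm_sq_to_K, hv]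
    · rw [exp_apply_of_apply_eq_smul (μ := 0)]
      · rw [re_inner_real_smul, hbb]
        simp
      · simp [hin, h]
  calc _ ≤ ∑ i : u, ((if i = ⟨v, hvu'⟩ then Real.exp t else 0) + 1) :=
        Finset.sum_le_sum fun i _ => key i
    _ = _ := by simp [Finset.sum_add_distrib]

/-- The Löwner order is detected by the functions `X ↦ tr exp (X + A)`. -/
theorem le_iff_realTrace_exp_add_le {A B : H →L[ℂ] H} (hA : IsSelfAdjoint A)
    (hB : IsSelfAdjoint B) :
    A ≤ B ↔ ∀ X : H →L[ℂ] H, IsSelfAdjoint X →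
      realTrace (NormedSpace.exp (X + A)) ≤ realTrace (NormedSpace.exp (X + B)) := by
  refine ⟨fun h X hX => realTrace_exp_mono (hX.add hA) (hX.add hB) (by gcongr), fun h => ?_⟩
  rw [ContinuousLinearMap.le_def, ContinuousLinearMap.isPositive_def']
  refine ⟨hB.sub hA, fun w => ?_⟩
  by_contra! hneg
  have hw : w ≠ 0 := by
    rintro rfl
    simp [ContinuousLinearMap.reApplyInnerSelf_apply] at hneg
  obtain ⟨v, r, hv, hvr⟩ : ∃ (v : H) (r : ℝ), ‖v‖ = 1 ∧ w = r • v :=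
    ⟨(‖w‖⁻¹ : ℝ) • w, ‖w‖, by simp [norm_smul, hw], by simp [smul_smul, hw]⟩
  have hneg' : (⟪v, (B - A) v⟫_ℂ).re < 0 := by
    rw [ContinuousLinearMap.reApplyInnerSelf_apply, ← inner_re_symm, RCLike.re_eq_complex_re, hvr,
      ContinuousLinearMap.map_smul_of_tower, re_inner_real_smul, ← RCLike.re_eq_complex_re,
      inner_re_symm, RCLike.re_eq_complex_re, re_inner_real_smul, ← RCLike.re_eq_complex_re,
      inner_re_symm, RCLike.re_eq_complex_re] at hneg
    nlinarith [mul_self_nonneg r]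
  set δ := (⟪v, (A - B) v⟫_ℂ).re with hδdef
  have hδ : 0 < δ := by
    rw [← neg_sub, neg_apply, inner_neg_right, Complex.neg_re] at hδdef
    linarith
  have hP : IsSelfAdjoint (InnerProductSpace.rankOne ℂ v v) :=
    (InnerProductSpace.isPositive_rankOne_self v).isSelfAdjoint
  have main : ∀ t : ℝ, Real.exp t * (Real.exp δ - 1) ≤ Module.finrank ℂ H := by
    intro t
    have htP : IsSelfAdjoint (t • InnerProductSpace.rankOne ℂ v v) := (IsSelfAdjoint.all t).smul hP
    -- With `P` the projection onto `v` and `X = t P - B`, the right side is `tr exp (t P) ≤ exp t +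
    -- dim H`, while `X + A` has expectation `t + δ` at `v`, so the left side is at least `exp (t +
    -- δ)`.
    have h1 := h (t • InnerProductSpace.rankOne ℂ v v - B) (htP.sub hB)
    rw [sub_add_cancel] at h1
    have h2 := inner_le_realTrace_exp ((htP.sub hB).add hA) hv
    have h3 := realTrace_exp_smul_rankOne hv t
    have h4 : (⟪v, (t • InnerProductSpace.rankOne ℂ v v - B + A) v⟫_ℂ).re = t + δ := by
      have hPv : InnerProductSpace.rankOne ℂ v v v = v := by
        simp [inner_self_eq_norm_sq_to_K, hv]
      simp only [hδdef, _root_.sub_apply, _root_.add_apply,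
        _root_.smul_apply, hPv, inner_add_right, inner_sub_right, Complex.add_re,
        Complex.sub_re, re_inner_real_smul, re_inner_self_of_norm_eq_one hv]
      ring
    rw [h4, Real.exp_add] at h2
    linarith
  have hpos : 0 < Real.exp δ - 1 := by
    have := Real.add_one_lt_exp hδ.ne'
    linarith
  -- By `exp t ≥ t + 1`, this `t` is already large enough to violate `main`.
  have h5 := main (Module.finrank ℂ H / (Real.exp δ - 1))
  have h6 := Real.add_one_le_exp (Module.finrank ℂ H / (Real.exp δ - 1))
  have h7 := mul_le_mul_of_nonneg_right h6 hpos.le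
  have h8 : (Module.finrank ℂ H / (Real.exp δ - 1) + 1) * (Real.exp δ - 1) =
    Module.finrank ℂ H + (Real.exp δ - 1) := by field_simp
  linarith

end TraceExp

/-! ### From the trace identity to a linear isometry. -/

section SelfAdjointMaps

variable {H : Type*} [NormedAddCommGroup H] [InnerProductSpace ℂ H] [CompleteSpace H]


theorem IsSelfAdjoint.norm_le_iff_le_smul_one {A : Type*} [CStarAlgebra A] [PartialOrder A]
    [StarOrderedRing A] {a : A} (ha : IsSelfAdjoint a) {s : ℝ} (hs : 0 ≤ s) :
    ‖a‖ ≤ s ↔ a ≤ s • 1 ∧ -a ≤ s • 1 := by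
  simp_rw [← Algebra.algebraMap_eq_smul_one]
  constructor
  · intro h
    have hm : algebraMap ℝ A ‖a‖ ≤ algebraMap ℝ A s := algebraMap_mono A h
    exact ⟨ha.le_algebraMap_norm_self.trans hm, (neg_le.1 ha.neg_algebraMap_norm_le_self).trans hm⟩
  · rintro ⟨h1, h2⟩
    rcases subsingleton_or_nontrivial A with h | h
    · simpa [Subsingleton.elim a 0] using hs
    rcases CStarAlgebra.norm_or_neg_norm_mem_spectrum ha with h | h
    · exact (le_algebraMap_iff_spectrum_le (ha := ha)).1 h1 _ h
    · refine (le_algebraMap_iff_spectrum_le (ha := ha.neg)).1 h2 _ ?_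
      rw [← spectrum.neg_eq]
      simpa using h

variable [FiniteDimensional ℂ H]

/-- In the order criterion the test operators can be written `α x`, or `α ψ(x)` by surjectivity; the
factor `c x` then cancels, and the shift by `s` only multiplies the trace by `exp s`. The factor `β`
stays because its sign is not fixed. -/
theorem smul_le_add_iff_of_realTrace_exp [Nontrivial H] {α β : ℝ} (hα : α ≠ 0)
    {ψ : selfAdjoint (H →L[ℂ] H) → selfAdjoint (H →L[ℂ] H)} (hψ : Function.Surjective ψ)
    {c : selfAdjoint (H →L[ℂ] H) → ℝ} (hc : ∀ a, 0 < c a)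
    (h : ∀ a b, realTrace (NormedSpace.exp (α • (ψ a).1 + β • (ψ b).1)) =
      c a * realTrace (NormedSpace.exp (α • a.1 + β • b.1)))
    (a b : selfAdjoint (H →L[ℂ] H)) (s : ℝ) :
    β • (ψ a).1 ≤ β • (ψ b).1 + s • 1 ↔ β • a.1 ≤ β • b.1 + s • 1 := by
  have hsa : ∀ x : selfAdjoint (H →L[ℂ] H), IsSelfAdjoint (β • x.1) :=
    fun x => (IsSelfAdjoint.all β).smul x.2
  have hone : IsSelfAdjoint (s • (1 : H →L[ℂ] H)) := (IsSelfAdjoint.all s).smul (.one _)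
  rw [le_iff_realTrace_exp_add_le (hsa _) ((hsa _).add hone),
    le_iff_realTrace_exp_add_le (hsa _) ((hsa _).add hone)]
  have key : ∀ x : selfAdjoint (H →L[ℂ] H),
      realTrace (NormedSpace.exp (α • (ψ x).1 + β • (ψ a).1)) ≤
        realTrace (NormedSpace.exp (α • (ψ x).1 + (β • (ψ b).1 + s • 1))) ↔
      realTrace (NormedSpace.exp (α • x.1 + β • a.1)) ≤
        realTrace (NormedSpace.exp (α • x.1 + (β • b.1 + s • 1))) := by
    intro x
    rw [← add_assoc, ← add_assoc, exp_add_smul_one, exp_add_smul_one, realTrace_smul,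
      realTrace_smul, h, h, mul_left_comm]
    exact mul_le_mul_iff_right₀ (hc x)
  have scale : ∀ X : H →L[ℂ] H, IsSelfAdjoint X → ∃ y : selfAdjoint (H →L[ℂ] H), X = α • y.1 :=
    fun X hX => ⟨α⁻¹ • ⟨X, hX⟩, by simp [smul_smul, hα]⟩
  constructor
  · intro hle X hX
    obtain ⟨x, rfl⟩ := scale X hX
    exact (key x).1 (hle _ ((IsSelfAdjoint.all α).smul (ψ x).2))
  · intro hle X hX
    obtain ⟨y, rfl⟩ := scale X hX
    obtain ⟨x, rfl⟩ := hψ y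
    exact (key x).2 (hle _ ((IsSelfAdjoint.all α).smul x.2))

set_option synthInstance.maxHeartbeats 200000 in
theorem exists_linearIsometryEquiv_of_realTrace_exp [Nontrivial H] {α β : ℝ} (hα : α ≠ 0)
    (hβ : β ≠ 0)
    {ψ : selfAdjoint (H →L[ℂ] H) → selfAdjoint (H →L[ℂ] H)} (hψ : Function.Bijective ψ)
    {c : selfAdjoint (H →L[ℂ] H) → ℝ} (hc : ∀ a, 0 < c a)
    (h : ∀ a b, realTrace (NormedSpace.exp (α • (ψ a).1 + β • (ψ b).1)) =
      c a * realTrace (NormedSpace.exp (α • a.1 + β • b.1))) :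
    ∃ L : selfAdjoint (H →L[ℂ] H) ≃ₗᵢ[ℝ] selfAdjoint (H →L[ℂ] H),
      (∀ a, ψ a = L a + ψ 0) ∧ ∀ (a : selfAdjoint (H →L[ℂ] H)) (s : ℝ),
        (L a).1 ≤ s • 1 ↔ a.1 ≤ s • 1 := by
  have key := smul_le_add_iff_of_realTrace_exp hα hψ.2 hc h
  have hnorm : ∀ (a b : selfAdjoint (H →L[ℂ] H)) (s : ℝ), 0 ≤ s →
      (‖β • a.1 - β • b.1‖ ≤ s ↔
        β • a.1 ≤ β • b.1 + s • 1 ∧ β • b.1 ≤ β • a.1 + s • 1) := by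
    intro a b s hs
    rw [IsSelfAdjoint.norm_le_iff_le_smul_one
      (((IsSelfAdjoint.all β).smul a.2).sub ((IsSelfAdjoint.all β).smul b.2)) hs, neg_sub,
      sub_le_iff_le_add', sub_le_iff_le_add']
  have hiso : Isometry ψ := by
    refine Isometry.of_dist_eq fun a b => ?_
    have h1 : ‖β • (ψ a).1 - β • (ψ b).1‖ = ‖β • a.1 - β • b.1‖ := by
      apply le_antisymm
      · rw [hnorm _ _ _ (norm_nonneg _), key, key, ← hnorm _ _ _ (norm_nonneg _)]
      · rw [hnorm _ _ _ (norm_nonneg _), ← key a b, ← key b a, ← hnorm _ _ _ (norm_nonneg _)]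
    rw [← smul_sub, ← smul_sub, norm_smul, norm_smul] at h1
    have h2 := mul_left_cancel₀ (norm_ne_zero_iff.2 hβ) h1
    rw [dist_eq_norm, dist_eq_norm]
    exact h2
  let e : selfAdjoint (H →L[ℂ] H) ≃ᵢ selfAdjoint (H →L[ℂ] H) :=
    ⟨Equiv.ofBijective ψ hψ, hiso⟩
  have hL : ∀ a, e.toRealLinearIsometryEquiv a = ψ a - ψ 0 :=
    fun a => e.toRealLinearIsometryEquiv_apply a
  refine ⟨e.toRealLinearIsometryEquiv, fun a => by rw [hL, sub_add_cancel], fun a s => ?_⟩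
  -- Rescaling by `β⁻¹` inside and `β` outside, allowed by linearity, absorbs the sign of `β`.
  have h1 : e.toRealLinearIsometryEquiv a = β • (ψ (β⁻¹ • a) - ψ 0) := by
    have hβa : β • β⁻¹ • a = a := Subtype.ext (smul_inv_smul₀ hβ a.1)
    rw [← hL, ← map_smul, hβa]
  have h2 := key (β⁻¹ • a) 0 s
  rw [h1]
  simp only [AddSubgroup.coe_sub, selfAdjoint.val_smul, smul_sub]
  rw [sub_le_iff_le_add', h2]
  simp [smul_smul, hβ]

end SelfAdjointMaps

/-! ### Jordan homomorphisms and Herstein's theorem. -/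

section Jordan

/-- A Jordan homomorphism is an additive map that preserves squares. -/
structure IsJordanHom {R S : Type*} [Ring R] [Ring S] (J : R →+ S) : Prop where
  map_mul_self : ∀ a, J (a * a) = J a * J a

namespace IsJordanHom

variable {R S : Type*} [Ring R] [Ring S] {J : R →+ S} (hJ : IsJordanHom J)
include hJ

theorem map_mul_add_mul (a b : R) : J (a * b + b * a) = J a * J b + J b * J a := by
  have h := hJ.map_mul_self (a + b)
  have h1 : (a + b) * (a + b) = a * a + b * b + (a * b + b * a) := by noncomm_ring
  rw [h1, map_add, map_add, hJ.map_mul_self, hJ.map_mul_self, map_add J a b] at h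
  have h2 : J (a * b + b * a) = (J a + J b) * (J a + J b) - (J a * J a + J b * J b) :=
    eq_sub_of_add_eq' h
  rw [h2]
  noncomm_ring

variable (htwo : ∀ s : S, s + s = 0 → s = 0)
include htwo

theorem map_mul_mul_self (a b : R) : J (a * b * a) = J a * J b * J a := by
  have h1 := hJ.map_mul_add_mul a (a * b + b * a)
  have h2 := hJ.map_mul_add_mul (a * a) b
  have h3 : a * (a * b + b * a) + (a * b + b * a) * a =
      (a * a * b + b * (a * a)) + (a * b * a + a * b * a) := by noncomm_ring
  rw [h3, map_add, h2, hJ.map_mul_add_mul, hJ.map_mul_self, map_add] at h1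
  have h4 := eq_sub_of_add_eq' h1
  rw [← sub_eq_zero]
  apply htwo
  have h5 : J (a * b * a) - J a * J b * J a + (J (a * b * a) - J a * J b * J a) =
    (J (a * b * a) + J (a * b * a)) - (J a * J b * J a + J a * J b * J a) := by abel
  rw [h5, h4]
  noncomm_ring

theorem map_triple (a b c : R) :
    J (a * b * c + c * b * a) = J a * J b * J c + J c * J b * J a := by
  have h := hJ.map_mul_mul_self htwo (a + c) b
  have h1 : (a + c) * b * (a + c) = a * b * a + c * b * c + (a * b * c + c * b * a) := by
    noncomm_ring
  rw [h1, map_add, map_add, hJ.map_mul_mul_self htwo, hJ.map_mul_mul_self htwo, map_add J a c] at h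
  rw [eq_sub_of_add_eq' h]
  noncomm_ring

/-- Compute `J (a b x b a + b a x a b)` in two ways: by nesting `map_mul_mul_self`, and by
`map_triple` applied to `a b`, `x`, `b a`. -/
theorem mul_mul_add_mul_mul_eq_zero (a b x : R) :
    (J (a * b) - J a * J b) * J x * (J (a * b) - J b * J a) +
      (J (a * b) - J b * J a) * J x * (J (a * b) - J a * J b) = 0 := by
  have h1 : J (a * b * x * (b * a) + b * a * x * (a * b)) =
      J a * (J b * J x * J b) * J a + J b * (J a * J x * J a) * J b := by
    rw [← hJ.map_mul_mul_self htwo b x, ← hJ.map_mul_mul_self htwo a x,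
      ← hJ.map_mul_mul_self htwo, ← hJ.map_mul_mul_self htwo, ← map_add]
    congr 1
    noncomm_ring
  have h2 := hJ.map_triple htwo (a * b) x (b * a)
  have h3 : J (b * a) = J a * J b + J b * J a - J (a * b) := by
    rw [← hJ.map_mul_add_mul, map_add]
    abel
  rw [h1, h3] at h2
  rw [← sub_eq_zero] at h2
  rw [← h2]
  noncomm_ring

/-- Jordan homomorphisms onto prime rings are homomorphisms or antihomomorphisms (Herstein). -/
theorem map_mul_or_map_mul_rev (hsurj : Function.Surjective J)
    (hprime : ∀ s t : S, (∀ x, s * x * t + t * x * s = 0) → s = 0 ∨ t = 0) :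
    (∀ a b, J (a * b) = J a * J b) ∨ (∀ a b, J (a * b) = J b * J a) := by
  have h0 : ∀ a b, J (a * b) = J a * J b ∨ J (a * b) = J b * J a := by
    intro a b
    rw [← sub_eq_zero, ← sub_eq_zero (b := J b * J a)]
    refine hprime _ _ fun y => ?_
    obtain ⟨x, rfl⟩ := hsurj y
    exact hJ.mul_mul_add_mul_mul_eq_zero htwo a b x
  -- A group is not the union of two proper subgroups; this is used here in the variable `b`, and
  -- once more below in `a`.
  have h1 : ∀ a, (∀ b, J (a * b) = J a * J b) ∨ (∀ b, J (a * b) = J b * J a) := by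
    intro a
    by_contra! hcon
    obtain ⟨⟨b, hb⟩, c, hc⟩ := hcon
    have hb' := (h0 a b).resolve_left hb
    have hc' := (h0 a c).resolve_right hc
    rcases h0 a (b + c) with h | h <;> rw [mul_add, map_add, map_add] at h
    · rw [hc', mul_add] at h
      exact hb (add_right_cancel h)
    · rw [hb', add_mul] at h
      exact hc (add_left_cancel h)
  by_contra! hcon
  obtain ⟨⟨a, b, hab⟩, c, d, hcd⟩ := hcon
  have ha := (h1 a).resolve_left fun h => hab (h b)
  have hc := (h1 c).resolve_right fun h => hcd (h d)
  rcases h1 (a + c) with h | h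
  · have := h b
    rw [add_mul, map_add, map_add, hc, add_mul] at this
    exact hab (add_right_cancel this)
  · have := h d
    rw [add_mul, map_add, map_add, ha, mul_add] at this
    exact hcd (add_left_cancel this)

end IsJordanHom

/-- Rank-one operators `x` suffice. If `s w ≠ 0`, testing against `s w` makes `t w` a multiple of `s
w`, then shows that the multiple is zero, and finally gives `t = 0`. -/
theorem ContinuousLinearMap.eq_zero_or_eq_zero_of_mul_mul_add_eq_zero {H : Type*}
    [NormedAddCommGroup H] [InnerProductSpace ℂ H] (s t : H →L[ℂ] H)
    (h : ∀ x : H →L[ℂ] H, s * x * t + t * x * s = 0) : s = 0 ∨ t = 0 := by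
  by_contra! hcon
  obtain ⟨hs, ht⟩ := hcon
  obtain ⟨w, hw⟩ : ∃ w, s w ≠ 0 := by
    by_contra! hc
    exact hs (ContinuousLinearMap.ext hc)
  have key : ∀ u v z : H, inner ℂ u (t z) • s v + inner ℂ u (s z) • t v = 0 := by
    intro u v z
    have := congrArg (fun f : H →L[ℂ] H => f z) (h (InnerProductSpace.rankOne ℂ v u))
    simpa using this
  have hcol : ∀ v, ∃ c : ℂ, t v = c • s v := by
    intro v
    have h1 := key (s w) v w
    have hne : inner ℂ (s w) (s w) ≠ 0 := by simpa using hw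
    refine ⟨-(inner ℂ (s w) (t w) / inner ℂ (s w) (s w)), ?_⟩
    rw [← sub_eq_zero, neg_smul, sub_neg_eq_add]
    have h2 := congrArg (fun y => (inner ℂ (s w) (s w))⁻¹ • y) h1
    simp only [smul_add, smul_zero, smul_smul, inv_mul_cancel₀ hne, one_smul] at h2
    rw [add_comm, div_eq_inv_mul]
    exact h2
  obtain ⟨c, hc⟩ := hcol w
  have hne : inner ℂ (s w) (s w) ≠ 0 := by simpa using hw
  have h1 := key (s w) w w
  rw [hc, inner_smul_right, smul_smul, ← add_smul] at h1
  have hc0 : c = 0 := by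
    have h2 := (smul_eq_zero.1 h1).resolve_right hw
    have h3 : c * inner ℂ (s w) (s w) = 0 := by linear_combination h2 / 2
    exact (mul_eq_zero.1 h3).resolve_right hne
  rw [hc0, zero_smul] at hc
  refine ht (ContinuousLinearMap.ext fun v => ?_)
  have h2 := key (s w) v w
  rw [hc, inner_zero_right, zero_smul, zero_add] at h2
  exact (smul_eq_zero.1 h2).resolve_left hne

end Jordan

/-! ### Preservation of projections and of squares. -/

section Projections

variable {H : Type*} [NormedAddCommGroup H] [InnerProductSpace ℂ H] [CompleteSpace H]

theorem IsStarProjection.map_of_le_smul_one_iff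
    (L : selfAdjoint (H →L[ℂ] H) ≃ₗᵢ[ℝ] selfAdjoint (H →L[ℂ] H))
    (hL : ∀ (a : selfAdjoint (H →L[ℂ] H)) (s : ℝ), (L a).1 ≤ s • 1 ↔ a.1 ≤ s • 1)
    {p : selfAdjoint (H →L[ℂ] H)} (hp : IsStarProjection p.1) : IsStarProjection (L p).1 := by
  have hnonneg : ∀ a, 0 ≤ (L a).1 ↔ 0 ≤ a.1 := by
    intro a
    have h := hL (-a) 0
    rw [show L (-a) = -L a from L.toLinearEquiv.map_neg a] at h
    simpa using h
  have hmem : ∀ a : selfAdjoint (H →L[ℂ] H),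
      (L a).1 ∈ {x : H →L[ℂ] H | 0 ≤ x} ∩ Metric.closedBall 0 1 ↔
        a.1 ∈ {x : H →L[ℂ] H | 0 ≤ x} ∩ Metric.closedBall 0 1 := by
    intro a
    have hn : ‖(L a).1‖ = ‖a.1‖ := L.norm_map a
    simp only [Set.mem_inter_iff, Set.mem_ofPred_eq, mem_closedBall_zero_iff, hnonneg, hn]
  rw [isStarProjection_iff_mem_extremePoints_setOfPred_nonneg_inter_unitClosedBall,
    mem_extremePoints_iff_left] at hp ⊢
  refine ⟨(hmem p).2 hp.1, ?_⟩
  rintro x hx y hy ⟨r, t, hr, ht, hrt, hxy⟩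
  have hxs : IsSelfAdjoint x := .of_nonneg hx.1
  have hys : IsSelfAdjoint y := .of_nonneg hy.1
  obtain ⟨x', hx'⟩ := L.surjective ⟨x, hxs⟩
  obtain ⟨y', hy'⟩ := L.surjective ⟨y, hys⟩
  have hxv : (L x').1 = x := congrArg Subtype.val hx'
  have hyv : (L y').1 = y := congrArg Subtype.val hy'
  have hsum : r • x' + t • y' = p := by
    apply L.injective
    rw [map_add, map_smul, map_smul]
    exact Subtype.ext (by rw [← hxy, ← hxv, ← hyv]; rfl)
  have := hp.2 x'.1 ((hmem x').1 (hxv ▸ hx)) y'.1 ((hmem y').1 (hyv ▸ hy))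
    ⟨r, t, hr, ht, hrt, by rw [← hsum]; rfl⟩
  rw [← hxv, Subtype.ext this]

variable [FiniteDimensional ℂ H]

/-- Write `a = ∑ μ i • P i` spectrally. Since `P i + P j` is again a projection for `i ≠ j`, the
images of `P i` and `P j` have zero anticommutator, so the cross terms in the square of `L a`
cancel. -/
theorem map_mul_self_of_isStarProjection
    (L : selfAdjoint (H →L[ℂ] H) →ₗ[ℝ] selfAdjoint (H →L[ℂ] H))
    (hL : ∀ p : selfAdjoint (H →L[ℂ] H), IsStarProjection p.1 → IsStarProjection (L p).1)
    (a b : selfAdjoint (H →L[ℂ] H)) (hb : b.1 = a.1 * a.1) :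
    (L b).1 = (L a).1 * (L a).1 := by
  have hs : (a.1 : H →ₗ[ℂ] H).IsSymmetric :=
    ContinuousLinearMap.isSelfAdjoint_iff_isSymmetric.mp a.2
  let e := hs.eigenvectorBasis rfl
  let μ := hs.eigenvalues rfl
  have hae : ∀ i, a.1 (e i) = μ i • e i := fun i => by
    rw [RCLike.real_smul_eq_coe_smul (K := ℂ)]
    exact hs.apply_eigenvectorBasis rfl i
  have he : ∀ i j, ⟪e i, e j⟫_ℂ = if i = j then 1 else 0 := orthonormal_iff_ite.1 e.orthonormal
  have hproj : ∀ i, IsStarProjection (InnerProductSpace.rankOne ℂ (e i) (e i)) :=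
    fun i => InnerProductSpace.isStarProjection_rankOne_self (e.orthonormal.1 i)
  let P : Fin (Module.finrank ℂ H) → selfAdjoint (H →L[ℂ] H) :=
    fun i => ⟨InnerProductSpace.rankOne ℂ (e i) (e i), (hproj i).isSelfAdjoint⟩
  have hPv : ∀ i, (P i).1 = InnerProductSpace.rankOne ℂ (e i) (e i) := fun i => rfl
  have hPP : ∀ i j, i ≠ j → (P i).1 * (P j).1 = 0 := by
    intro i j hij
    ext v
    simp [hPv, he, hij]
  have hdecomp : ∀ (x : selfAdjoint (H →L[ℂ] H)) (ν : Fin (Module.finrank ℂ H) → ℝ),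
      (∀ i, x.1 (e i) = ν i • e i) → x = ∑ i, ν i • P i := by
    intro x ν hx
    apply Subtype.ext
    apply ContinuousLinearMap.coe_injective
    refine e.toBasis.ext fun j => ?_
    have : (∑ i, ν i • P i : selfAdjoint (H →L[ℂ] H)).1 = ∑ i, ν i • (P i).1 := by
      rw [AddSubgroup.val_finsetSum]
      rfl
    rw [this]
    simp [hPv, hx, he]
  have ha := hdecomp a μ hae
  have hb' := hdecomp b (fun i => μ i * μ i) fun i => by
    rw [hb, mul_apply_eq_comp, hae, ContinuousLinearMap.map_smul_of_tower, hae, smul_smul]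
  have hQQ : ∀ i, (L (P i)).1 * (L (P i)).1 = (L (P i)).1 :=
    fun i => (hL _ (hproj i)).isIdempotentElem.eq
  have horth : ∀ i j, i ≠ j →
      (L (P i)).1 * (L (P j)).1 + (L (P j)).1 * (L (P i)).1 = 0 := by
    intro i j hij
    have h1 : IsStarProjection (P i + P j).1 := by
      refine ⟨?_, (P i + P j).2⟩
      change ((P i).1 + (P j).1) * ((P i).1 + (P j).1) = (P i).1 + (P j).1
      rw [add_mul, mul_add, mul_add, hPP i j hij, hPP j i hij.symm,
        (hproj i).isIdempotentElem.eq, (hproj j).isIdempotentElem.eq, zero_add, add_zero]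
    have h2 := (hL _ h1).isIdempotentElem.eq
    rw [map_add] at h2
    change ((L (P i)).1 + (L (P j)).1) * ((L (P i)).1 + (L (P j)).1) =
      (L (P i)).1 + (L (P j)).1 at h2
    rw [add_mul, mul_add, mul_add, hQQ, hQQ] at h2
    have h3 := sub_eq_zero.2 h2
    rw [← h3]
    abel
  have hLsum : ∀ ν : Fin (Module.finrank ℂ H) → ℝ,
      (L (∑ i, ν i • P i)).1 = ∑ i, ν i • (L (P i)).1 := by
    intro ν
    rw [map_sum, AddSubgroup.val_finsetSum]
    exact Finset.sum_congr rfl fun i _ => by rw [map_smul]; rfl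
  rw [hb', ha, hLsum, hLsum]
  have hsq : (∑ i, μ i • (L (P i)).1) * (∑ i, μ i • (L (P i)).1) =
      ∑ i, ∑ j, (μ i * μ j) • ((L (P i)).1 * (L (P j)).1) := by
    rw [Finset.sum_mul_sum]
    simp [smul_smul, mul_comm]
  have hcomm : ∑ i, ∑ j, (μ i * μ j) • ((L (P i)).1 * (L (P j)).1) =
      ∑ i, ∑ j, (μ i * μ j) • ((L (P j)).1 * (L (P i)).1) := by
    rw [Finset.sum_comm]
    simp [mul_comm]
  -- Only anticommutators are known to vanish, so the double sum is added to its transpose before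
  -- the off-diagonal terms are dropped.
  have htwo : (2 : ℝ) • ∑ i, ∑ j, (μ i * μ j) • ((L (P i)).1 * (L (P j)).1) =
      (2 : ℝ) • ∑ i, (μ i * μ i) • (L (P i)).1 := by
    rw [two_smul]
    nth_rewrite 2 [hcomm]
    rw [← Finset.sum_add_distrib, Finset.smul_sum]
    refine Finset.sum_congr rfl fun i _ => ?_
    rw [← Finset.sum_add_distrib, Finset.sum_eq_single i]
    · rw [hQQ, two_smul]
    · intro j _ hji
      rw [← smul_add, horth i j hji.symm, smul_zero]
    · simp
  rw [hsq]
  exact (smul_right_injective _ (two_ne_zero (α := ℝ)) htwo).symm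

end Projections

/-! ### Complexification of a real linear map. -/

section ComplexExtension

open scoped ComplexStarModule

variable {A : Type*} [Ring A] [StarRing A] [Algebra ℂ A] [StarModule ℂ A]

/-- The complex linear extension of a real linear map between self-adjoint parts. -/
def complexExtension (L : selfAdjoint A →ₗ[ℝ] selfAdjoint A) : A →ₗ[ℂ] A where
  toFun a := (L (ℜ a) : A) + Complex.I • (L (ℑ a) : A)
  map_add' a b := by
    simp only [map_add, AddSubgroup.coe_add, smul_add]
    abel
  map_smul' z a := by
    simp only [realPart_smul, imaginaryPart_smul, map_sub, map_add, map_smul, AddSubgroup.coe_sub,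
      AddSubgroup.coe_add, selfAdjoint.val_smul, RingHom.id_apply, ← Complex.coe_smul]
    nth_rewrite 5 [← Complex.re_add_im z]
    generalize (L (ℜ a) : A) = u, (L (ℑ a) : A) = v
    match_scalars
    · ring
    · linear_combination (-z.im : ℂ) * Complex.I_sq

variable (L : selfAdjoint A →ₗ[ℝ] selfAdjoint A)

theorem complexExtension_apply (a : A) :
    complexExtension L a = (L (ℜ a) : A) + Complex.I • (L (ℑ a) : A) := rfl

theorem complexExtension_coe (x : selfAdjoint A) : complexExtension L x = L x := by
  simp [complexExtension_apply]

theorem complexExtension_star (a : A) :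
    complexExtension L (star a) = star (complexExtension L a) := by
  have h1 : ℜ (star a) = ℜ a := Subtype.ext (by simp [realPart_apply_coe, add_comm])
  have h2 : ℑ (star a) = -ℑ a := Subtype.ext (by
    simp only [imaginaryPart_apply_coe, star_star, AddSubgroup.coe_neg, ← smul_neg, neg_sub])
  simp [complexExtension_apply, h1, h2]

theorem complexExtension_complexExtension {L L' : selfAdjoint A →ₗ[ℝ] selfAdjoint A}
    (h : ∀ x, L (L' x) = x) (a : A) : complexExtension L (complexExtension L' a) = a := by
  rw [complexExtension_apply L', map_add, map_smul, complexExtension_coe, complexExtension_coe,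
    h, h, realPart_add_I_smul_imaginaryPart]

theorem isJordanHom_complexExtension
    (h : ∀ a b : selfAdjoint A, (b : A) = a * a → (L b : A) = L a * L a) :
    IsJordanHom (complexExtension L).toAddMonoidHom where
  map_mul_self a := by
    have hsq : ∀ x : selfAdjoint A, complexExtension L ((x : A) * x) = L x * L x := by
      intro x
      have hx : IsSelfAdjoint ((x : A) * x) := by
        rw [isSelfAdjoint_iff, star_mul, x.2.star_eq]
      rw [← h x ⟨_, hx⟩ rfl, ← complexExtension_coe]
    have hadd : ∀ x y : selfAdjoint A,
        complexExtension L ((x : A) * y + y * x) = L x * L y + L y * L x := by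
      intro x y
      have h1 := hsq (x + y)
      have h2 : ((x + y : selfAdjoint A) : A) * (x + y : selfAdjoint A) =
          x * x + y * y + (x * y + y * x) := by
        rw [AddSubgroup.coe_add]
        noncomm_ring
      rw [h2, map_add, map_add (complexExtension L) ((x : A) * x), hsq, hsq] at h1
      rw [eq_sub_of_add_eq' h1, map_add, AddSubgroup.coe_add]
      noncomm_ring
    change complexExtension L (a * a) = complexExtension L a * complexExtension L a
    have hmul : ∀ u v : A, (u + Complex.I • v) * (u + Complex.I • v) =
        u * u - v * v + Complex.I • (u * v + v * u) := by
      intro u v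
      simp only [add_mul, mul_add, smul_mul_assoc, mul_smul_comm, smul_smul, Complex.I_mul_I,
        neg_smul, one_smul, smul_add]
      abel
    conv_lhs => rw [← realPart_add_I_smul_imaginaryPart a, hmul]
    rw [map_add, map_sub, map_smul, hsq, hsq, hadd, complexExtension_apply, hmul]

end ComplexExtension

/-! ### Conjugations and antiunitary operators. -/

section Conjugation

variable {H : Type*} [NormedAddCommGroup H] [InnerProductSpace ℂ H] {ι : Type*} [Fintype ι]

/-- The antiunitary operator that fixes the vectors of an orthonormal basis. -/
def OrthonormalBasis.conjugation (b : OrthonormalBasis ι ℂ H) : H ≃ₛₗᵢ[starRingEnd ℂ] H where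
  toFun x := ∑ i, ⟪x, b i⟫_ℂ • b i
  invFun x := ∑ i, ⟪x, b i⟫_ℂ • b i
  map_add' x y := by simp [add_smul, Finset.sum_add_distrib]
  map_smul' z x := by simp [Finset.smul_sum, smul_smul, mul_comm]
  left_inv x := by
    classical
    simp [orthonormal_iff_ite.1 b.orthonormal, b.sum_repr']
  right_inv x := by
    classical
    simp [orthonormal_iff_ite.1 b.orthonormal, b.sum_repr']
  norm_map' x := by
    have h1 : ∀ y : H, ‖y‖ ^ 2 = ∑ i, ‖⟪b i, y⟫_ℂ‖ ^ 2 := fun y => (b.sum_sq_norm_inner_right y).symm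
    refine (sq_eq_sq₀ (norm_nonneg _) (norm_nonneg _)).1 ?_
    classical
    rw [h1, h1]
    simp [orthonormal_iff_ite.1 b.orthonormal, norm_inner_symm]

namespace OrthonormalBasis

variable (b : OrthonormalBasis ι ℂ H)

theorem conjugation_apply (x : H) : b.conjugation x = ∑ i, ⟪x, b i⟫_ℂ • b i := rfl

theorem conjugation_symm : b.conjugation.symm = b.conjugation := rfl

theorem conjugation_conjugation (x : H) : b.conjugation (b.conjugation x) = x :=
  b.conjugation.symm_apply_apply x

theorem conjugation_self (i : ι) : b.conjugation (b i) = b i := by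
  classical
  simp [conjugation_apply, orthonormal_iff_ite.1 b.orthonormal]

theorem inner_conjugation_conjugation (x y : H) :
    ⟪b.conjugation x, b.conjugation y⟫_ℂ = ⟪y, x⟫_ℂ := by
  classical
  rw [← b.sum_inner_mul_inner y x]
  simp [conjugation_apply, orthonormal_iff_ite.1 b.orthonormal]

theorem inner_conjugation_left (x y : H) :
    ⟪b.conjugation x, y⟫_ℂ = ⟪b.conjugation y, x⟫_ℂ := by
  rw [← b.inner_conjugation_conjugation x, conjugation_conjugation]

end OrthonormalBasis

end Conjugation

section AntiunitaryConj

variable {H : Type*} [NormedAddCommGroup H] [InnerProductSpace ℂ H]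

theorem antiunitaryConj_apply (U : H ≃ₛₗᵢ[starRingEnd ℂ] H) (A : H →L[ℂ] H) (x : H) :
    antiunitaryConj U A x = U (A (U.symm x)) := rfl

theorem antiunitaryConj_mul (U : H ≃ₛₗᵢ[starRingEnd ℂ] H) (A B : H →L[ℂ] H) :
    antiunitaryConj U (A * B) = antiunitaryConj U A * antiunitaryConj U B := by
  ext x
  simp [antiunitaryConj_apply]

theorem antiunitaryConj_add (U : H ≃ₛₗᵢ[starRingEnd ℂ] H) (A B : H →L[ℂ] H) :
    antiunitaryConj U (A + B) = antiunitaryConj U A + antiunitaryConj U B := by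
  ext x
  simp [antiunitaryConj_apply]

theorem antiunitaryConj_smul (U : H ≃ₛₗᵢ[starRingEnd ℂ] H) (z : ℂ) (A : H →L[ℂ] H) :
    antiunitaryConj U (z • A) = star z • antiunitaryConj U A := by
  ext x
  simp [antiunitaryConj_apply, map_smulₛₗ]

variable {ι : Type*} [Fintype ι] (b : OrthonormalBasis ι ℂ H)

theorem antiunitaryConj_conjugation_conjugation (A : H →L[ℂ] H) :
    antiunitaryConj b.conjugation (antiunitaryConj b.conjugation A) = A := by
  ext x
  simp [antiunitaryConj_apply, b.conjugation_symm, b.conjugation_conjugation]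

theorem realTrace_antiunitaryConj_conjugation (A : H →L[ℂ] H) :
    realTrace (antiunitaryConj b.conjugation A) = realTrace A := by
  rw [realTrace_eq_sum_inner b, realTrace_eq_sum_inner b]
  refine Finset.sum_congr rfl fun i _ => ?_
  rw [antiunitaryConj_apply, b.conjugation_symm, ← inner_conj_symm, b.inner_conjugation_left,
    b.conjugation_self, Complex.conj_re]

theorem star_antiunitaryConj_conjugation [CompleteSpace H] (A : H →L[ℂ] H) :
    star (antiunitaryConj b.conjugation A) = antiunitaryConj b.conjugation (star A) := by
  rw [ContinuousLinearMap.star_eq_adjoint, ContinuousLinearMap.star_eq_adjoint, eq_comm,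
    ContinuousLinearMap.eq_adjoint_iff]
  intro x y
  simp only [antiunitaryConj_apply, b.conjugation_symm]
  rw [b.inner_conjugation_left, ContinuousLinearMap.adjoint_inner_right,
    ← b.inner_conjugation_conjugation, b.conjugation_conjugation]

end AntiunitaryConj

/-! ### Spatial implementation of Jordan automorphisms. -/

section Conjugation

variable {H : Type*} [NormedAddCommGroup H] [InnerProductSpace ℂ H] [CompleteSpace H]

/-- Real linearity of `V` is enough because the exponential series has real coefficients; this
covers unitary and antiunitary operators alike. -/
theorem exp_apply_of_intertwine {A B : H →L[ℂ] H} (V : H →L[ℝ] H) (h : ∀ x, B (V x) = V (A x))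
    (x : H) : NormedSpace.exp B (V x) = V (NormedSpace.exp A x) := by
  have hpow : ∀ n : ℕ, (B ^ n) (V x) = V ((A ^ n) x) := by
    intro n
    induction n with
    | zero => simp
    | succ n ih => rw [pow_succ', pow_succ', mul_apply_eq_comp, mul_apply_eq_comp, ih, h]
  have h1 : HasSum (fun n : ℕ => ((n.factorial : ℝ)⁻¹ • B ^ n) (V x)) (NormedSpace.exp B (V x)) :=
    (NormedSpace.exp_series_hasSum_exp' (𝕂 := ℝ) B).mapL (ContinuousLinearMap.apply ℂ H (V x))
  have h2 : HasSum (fun n : ℕ => V (((n.factorial : ℝ)⁻¹ • A ^ n) x)) (V (NormedSpace.exp A x)) :=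
    ((NormedSpace.exp_series_hasSum_exp' (𝕂 := ℝ) A).mapL
      (ContinuousLinearMap.apply ℂ H x)).mapL V
  refine h1.unique (h2.congr_fun ?_)
  intro n
  simp [hpow]

theorem exp_conjStarAlgEquiv (U : H ≃ₗᵢ[ℂ] H) (A : H →L[ℂ] H) :
    NormedSpace.exp (U.conjStarAlgEquiv A) = U.conjStarAlgEquiv (NormedSpace.exp A) := by
  ext x
  have h := exp_apply_of_intertwine (A := A) (B := U.conjStarAlgEquiv A)
    ((U : H →L[ℂ] H).restrictScalars ℝ) (fun x => by simp) (U.symm x)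
  simpa using h

theorem exp_antiunitaryConj (U : H ≃ₛₗᵢ[starRingEnd ℂ] H) (A : H →L[ℂ] H) :
    NormedSpace.exp (antiunitaryConj U A) = antiunitaryConj U (NormedSpace.exp A) := by
  ext x
  let V : H →L[ℝ] H :=
    { toFun := U
      map_add' := U.map_add
      map_smul' := fun r y => by
        rw [RCLike.real_smul_eq_coe_smul (K := ℂ), U.map_smulₛₗ]
        simp
      cont := U.continuous }
  have hV : ∀ y, V y = U y := fun _ => rfl
  have h := exp_apply_of_intertwine (A := A) (B := antiunitaryConj U A) V
    (fun x => by simp [hV, antiunitaryConj_apply]) (U.symm x)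
  simpa [hV, antiunitaryConj_apply] using h

theorem realTrace_conjStarAlgEquiv [FiniteDimensional ℂ H] (U : H ≃ₗᵢ[ℂ] H) (A : H →L[ℂ] H) :
    realTrace (U.conjStarAlgEquiv A) = realTrace A := by
  have b := stdOrthonormalBasis ℂ H
  rw [realTrace_eq_sum_inner (b.map U), realTrace_eq_sum_inner b]
  simp

theorem exists_conjStarAlgEquiv_of_linearMap [FiniteDimensional ℂ H]
    (J : (H →L[ℂ] H) →ₗ[ℂ] (H →L[ℂ] H)) (hbij : Function.Bijective J)
    (hmul : ∀ a b, J (a * b) = J a * J b) (hstar : ∀ a, J (star a) = star (J a)) :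
    ∃ U : H ≃ₗᵢ[ℂ] H, ∀ a, J a = U.conjStarAlgEquiv a := by
  have hone : J 1 = 1 := by
    obtain ⟨u, hu⟩ := hbij.2 1
    have h := hmul 1 u
    rw [one_mul, hu, mul_one] at h
    exact h.symm
  let f : (H →L[ℂ] H) ≃ₐ[ℂ] (H →L[ℂ] H) :=
    AlgEquiv.ofBijective (AlgHom.ofLinearMap J hone hmul) hbij
  let g : (H →L[ℂ] H) ≃⋆ₐ[ℂ] (H →L[ℂ] H) := .ofAlgEquiv f hstar
  have hgJ : ∀ a, g a = J a := fun _ => rfl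
  obtain ⟨U, hU⟩ := g.eq_linearIsometryEquivConjStarAlgEquiv
    (LinearMap.continuous_of_finiteDimensional J)
  exact ⟨U, fun a => by rw [← hgJ, hU]⟩

/-- A Jordan `*`-automorphism of the algebra of operators is given by a unitary or an
antiunitary operator. -/
theorem IsJordanHom.exists_unitary_or_antiunitary [FiniteDimensional ℂ H]
    (J : (H →L[ℂ] H) →ₗ[ℂ] (H →L[ℂ] H)) (hbij : Function.Bijective J)
    (hJ : IsJordanHom J.toAddMonoidHom) (hstar : ∀ a, J (star a) = star (J a)) :
    (∃ U : H ≃ₗᵢ[ℂ] H, ∀ a, J a = U.conjStarAlgEquiv a) ∨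
      ∃ U : H ≃ₛₗᵢ[starRingEnd ℂ] H, (∀ a, realTrace (antiunitaryConj U a) = realTrace a) ∧
        ∀ a, J (star a) = antiunitaryConj U a := by
  have htwo : ∀ s : H →L[ℂ] H, s + s = 0 → s = 0 := fun s hs => by
    rw [← two_smul ℂ] at hs
    exact (smul_eq_zero.1 hs).resolve_left two_ne_zero
  rcases hJ.map_mul_or_map_mul_rev htwo hbij.2
    ContinuousLinearMap.eq_zero_or_eq_zero_of_mul_mul_add_eq_zero with hmul | hmul
  · exact .inl (exists_conjStarAlgEquiv_of_linearMap J hbij hmul hstar)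
  · right
    let b := stdOrthonormalBasis ℂ H
    -- `T` is the transpose in the basis `b`: a linear, antimultiplicative involution. Hence `J ∘ T`
    -- is multiplicative and is implemented by a unitary operator.
    let T : (H →L[ℂ] H) →ₗ[ℂ] (H →L[ℂ] H) :=
      { toFun := fun a => antiunitaryConj b.conjugation (star a)
        map_add' := fun a c => by rw [star_add, antiunitaryConj_add]
        map_smul' := fun z a => by
          rw [star_smul, antiunitaryConj_smul, star_star, RingHom.id_apply] }
    have hT : ∀ a, T a = antiunitaryConj b.conjugation (star a) := fun _ => rfl
    have hTT : Function.Involutive T := fun a => by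
      rw [hT, hT, star_antiunitaryConj_conjugation, star_star,
        antiunitaryConj_conjugation_conjugation]
    obtain ⟨U, hU⟩ := exists_conjStarAlgEquiv_of_linearMap (J ∘ₗ T) (hbij.comp hTT.bijective)
      (fun a c => by
        have h := hmul (T c) (T a)
        simp only [LinearMap.comp_apply]
        rw [hT (a * c), star_mul, antiunitaryConj_mul, ← hT, ← hT]
        exact h)
      (fun a => by
        rw [LinearMap.comp_apply, LinearMap.comp_apply, ← hstar, hT, hT,
          star_antiunitaryConj_conjugation])
    have hform : ∀ a, antiunitaryConj (b.conjugation.trans U) a =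
        U.conjStarAlgEquiv (antiunitaryConj b.conjugation a) := fun a => by
      ext x
      simp [antiunitaryConj_apply]
    refine ⟨b.conjugation.trans U, fun a => ?_, fun a => ?_⟩
    · rw [hform, realTrace_conjStarAlgEquiv, realTrace_antiunitaryConj_conjugation]
    · rw [hform, ← hU, LinearMap.comp_apply, hT, star_antiunitaryConj_conjugation,
        antiunitaryConj_conjugation_conjugation]

end Conjugation

/-! ### Logarithmic coordinates and the scalar translation. -/

section Main

variable {H : Type*} [NormedAddCommGroup H] [InnerProductSpace ℂ H] [CompleteSpace H]

/-- The exponential is a bijection from the self-adjoint to the positive definite operators, with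
inverse the logarithm. -/
def expEquiv : selfAdjoint (H →L[ℂ] H) ≃ PosDefOp H where
  toFun a := ⟨NormedSpace.exp a.1, by
    rw [IsStrictlyPositive.iff_of_unital]
    let _ : NormedAlgebra ℚ (H →L[ℂ] H) := NormedAlgebra.restrictScalars ℚ ℂ _
    refine ⟨?_, NormedSpace.isUnit_exp _⟩
    rw [← CFC.real_exp_eq_normedSpace_exp a.2]
    exact cfc_nonneg fun x _ => (Real.exp_pos x).le⟩
  invFun A := ⟨CFC.log A.1, IsSelfAdjoint.log⟩
  left_inv a := Subtype.ext (CFC.log_exp a.1 a.2)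
  right_inv A := Subtype.ext (CFC.exp_log A.1 A.2)

theorem coe_expEquiv (a : selfAdjoint (H →L[ℂ] H)) : (expEquiv a).1 = NormedSpace.exp a.1 := rfl

theorem flatDivergence_expEquiv (α : ℝ) (a b : selfAdjoint (H →L[ℂ] H)) :
    flatDivergence α (expEquiv a) (expEquiv b) = (α - 1)⁻¹ *
      Real.log ((realTrace (NormedSpace.exp a.1))⁻¹ *
        realTrace (NormedSpace.exp (α • a.1 + (1 - α) • b.1))) := by
  rw [flatDivergence, coe_expEquiv, coe_expEquiv, CFC.log_exp a.1 a.2, CFC.log_exp b.1 b.2]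

variable [FiniteDimensional ℂ H]

/-- The surjective linear isometries of the self-adjoint operators that preserve upper scalar
bounds are conjugations by unitary or antiunitary operators. -/
theorem LinearIsometryEquiv.exists_unitary_or_antiunitary
    (L : selfAdjoint (H →L[ℂ] H) ≃ₗᵢ[ℝ] selfAdjoint (H →L[ℂ] H))
    (hL : ∀ (a : selfAdjoint (H →L[ℂ] H)) (s : ℝ), (L a).1 ≤ s • 1 ↔ a.1 ≤ s • 1) :
    (∃ U : H ≃ₗᵢ[ℂ] H, ∀ a, (L a).1 = U.conjStarAlgEquiv a.1) ∨
      ∃ U : H ≃ₛₗᵢ[starRingEnd ℂ] H, (∀ a, realTrace (antiunitaryConj U a) = realTrace a) ∧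
        ∀ a, (L a).1 = antiunitaryConj U a.1 := by
  let L₁ : selfAdjoint (H →L[ℂ] H) →ₗ[ℝ] selfAdjoint (H →L[ℂ] H) := L.toLinearEquiv.toLinearMap
  let L₂ : selfAdjoint (H →L[ℂ] H) →ₗ[ℝ] selfAdjoint (H →L[ℂ] H) :=
    L.symm.toLinearEquiv.toLinearMap
  have h12 : ∀ x, L₁ (L₂ x) = x := fun x => L.apply_symm_apply x
  have h21 : ∀ x, L₂ (L₁ x) = x := fun x => L.symm_apply_apply x
  have hL₁ : ∀ a : selfAdjoint (H →L[ℂ] H), complexExtension L₁ a.1 = (L a).1 :=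
    fun a => complexExtension_coe L₁ a
  have hbij : Function.Bijective (complexExtension L₁) :=
    Function.bijective_iff_has_inverse.2 ⟨complexExtension L₂,
      complexExtension_complexExtension h21, complexExtension_complexExtension h12⟩
  have hJ := isJordanHom_complexExtension L₁
    (map_mul_self_of_isStarProjection L₁ fun p hp => hp.map_of_le_smul_one_iff L hL)
  rcases hJ.exists_unitary_or_antiunitary _ hbij (complexExtension_star L₁) with
    ⟨U, hU⟩ | ⟨U, hUtr, hU⟩
  · exact .inl ⟨U, fun a => by rw [← hL₁, hU]⟩
  · exact .inr ⟨U, hUtr, fun a => by rw [← hL₁, ← hU, a.2.star_eq]⟩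

/-- The scalar `log c` has the same effect as `z` on every `tr exp (w + ·)`, so order detection in
both directions identifies them. -/
theorem eq_smul_one_of_realTrace_exp_add [Nontrivial H] {z : H →L[ℂ] H} (hz : IsSelfAdjoint z)
    {c : ℝ} (hc : 0 < c) (h : ∀ w : H →L[ℂ] H, IsSelfAdjoint w →
      realTrace (NormedSpace.exp (w + z)) = c * realTrace (NormedSpace.exp w)) :
    z = Real.log c • 1 := by
  have hone : IsSelfAdjoint (Real.log c • (1 : H →L[ℂ] H)) :=
    (IsSelfAdjoint.all _).smul (.one _)
  have key : ∀ w : H →L[ℂ] H, IsSelfAdjoint w → realTrace (NormedSpace.exp (w + z)) =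
      realTrace (NormedSpace.exp (w + Real.log c • 1)) := fun w hw => by
    rw [h w hw, exp_add_smul_one, realTrace_smul, Real.exp_log hc]
  exact le_antisymm ((le_iff_realTrace_exp_add_le hz hone).2 fun w hw => (key w hw).le)
    ((le_iff_realTrace_exp_add_le hone hz).2 fun w hw => (key w hw).ge)

/-- If `L` is implemented by `Φ`, which commutes with the exponential and preserves the trace, then
the translation part of a solution `a ↦ L a + z` of the trace equation is scalar. -/
theorem exp_add_eq_smul_of_realTrace_exp [Nontrivial H]
    {L : selfAdjoint (H →L[ℂ] H) → selfAdjoint (H →L[ℂ] H)} (hL : Function.Surjective L)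
    {Φ : (H →L[ℂ] H) → (H →L[ℂ] H)} (hΦ : ∀ a, (L a).1 = Φ a.1)
    (hexp : ∀ A, NormedSpace.exp (Φ A) = Φ (NormedSpace.exp A))
    (htr : ∀ A, realTrace (Φ A) = realTrace A)
    {z : selfAdjoint (H →L[ℂ] H)} {c : ℝ} (hc : 0 < c)
    (h : ∀ w, realTrace (NormedSpace.exp ((L w).1 + z.1)) = c * realTrace (NormedSpace.exp w.1))
    (a : selfAdjoint (H →L[ℂ] H)) :
    NormedSpace.exp ((L a).1 + z.1) = c • Φ (NormedSpace.exp a.1) := by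
  have hz : z.1 = Real.log c • 1 := by
    refine eq_smul_one_of_realTrace_exp_add z.2 hc fun w hw => ?_
    obtain ⟨w', hw'⟩ := hL ⟨w, hw⟩
    have hval : (L w').1 = w := congrArg Subtype.val hw'
    rw [← hval, h, hΦ, hexp, htr]
  rw [hz, exp_add_smul_one, Real.exp_log hc, hΦ, hexp]

end Main

end

theorem theorem1 {H : Type*} [NormedAddCommGroup H] [InnerProductSpace ℂ H] [CompleteSpace H]
    [FiniteDimensional ℂ H] (hdim : 2 ≤ Module.finrank ℂ H)
    (α : ℝ) (hα : α ∈ Set.Ioo (0 : ℝ) 1 ∪ Set.Ioi (1 : ℝ))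
    (φ : PosDefOp H → PosDefOp H) (hφ : Function.Bijective φ)
    (hpres : ∀ A B : PosDefOp H, flatDivergence α (φ A) (φ B) = flatDivergence α A B) :
    ∃ c : ℝ, 0 < c ∧
      ((∃ U ∈ unitary (H →L[ℂ] H), ∀ A : PosDefOp H, (φ A).1 = c • (U * A.1 * star U)) ∨
        (∃ U : H ≃ₛₗᵢ[starRingEnd ℂ] H, ∀ A : PosDefOp H,
          (φ A).1 = c • antiunitaryConj U A.1)) := by
  have : Nontrivial H := Module.nontrivial_of_finrank_pos (R := ℂ) (by omega)
  have hα0 : α ≠ 0 := by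
    rintro rfl
    rcases hα with h | h
    · exact lt_irrefl _ h.1
    · exact absurd (Set.mem_Ioi.1 h) (not_lt.2 zero_le_one)
  have hα1 : α ≠ 1 := by
    rintro rfl
    rcases hα with h | h
    · exact lt_irrefl _ h.2
    · exact lt_irrefl _ (Set.mem_Ioi.1 h)
  have hβ : 1 - α ≠ 0 := sub_ne_zero.2 hα1.symm
  let ψ : selfAdjoint (H →L[ℂ] H) → selfAdjoint (H →L[ℂ] H) := fun a =>
    expEquiv.symm (φ (expEquiv a))
  have hψbij : Function.Bijective ψ :=
    expEquiv.symm.bijective.comp (hφ.comp expEquiv.bijective)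
  have hψ : ∀ a, φ (expEquiv a) = expEquiv (ψ a) := fun a => (expEquiv.apply_symm_apply _).symm
  have hpos : ∀ a : selfAdjoint (H →L[ℂ] H), 0 < realTrace (NormedSpace.exp a.1) :=
    fun a => realTrace_exp_pos a.2
  have hcpos : ∀ a, 0 < realTrace (NormedSpace.exp (ψ a).1) / realTrace (NormedSpace.exp a.1) :=
    fun a => div_pos (hpos _) (hpos _)
  have hψtr : ∀ a b, realTrace (NormedSpace.exp (α • (ψ a).1 + (1 - α) • (ψ b).1)) =
      realTrace (NormedSpace.exp (ψ a).1) / realTrace (NormedSpace.exp a.1) *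
        realTrace (NormedSpace.exp (α • a.1 + (1 - α) • b.1)) := by
    intro a b
    have hcomb : ∀ x y : selfAdjoint (H →L[ℂ] H),
        0 < realTrace (NormedSpace.exp (α • x.1 + (1 - α) • y.1)) := fun x y =>
      realTrace_exp_pos (((IsSelfAdjoint.all α).smul x.2).add ((IsSelfAdjoint.all _).smul y.2))
    have h := hpres (expEquiv a) (expEquiv b)
    rw [hψ, hψ, flatDivergence_expEquiv, flatDivergence_expEquiv] at h
    have h1 := mul_left_cancel₀ (inv_ne_zero (sub_ne_zero.2 hα1)) h
    have h2 := Real.log_injOn_pos (mul_pos (inv_pos.2 (hpos _)) (hcomb _ _))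
      (mul_pos (inv_pos.2 (hpos _)) (hcomb _ _)) h1
    have h3 := (hpos a).ne'
    have h4 := (hpos (ψ a)).ne'
    field_simp at h2 ⊢
    linarith
  obtain ⟨L, hLψ, hL⟩ := exists_linearIsometryEquiv_of_realTrace_exp hα0 hβ hψbij hcpos hψtr
  set c := realTrace (NormedSpace.exp (ψ 0).1) / realTrace (NormedSpace.exp (0 : H →L[ℂ] H))
    with hcdef
  have hc : 0 < c := hcpos 0
  have htr : ∀ w, realTrace (NormedSpace.exp ((L w).1 + (ψ 0).1)) =
      c * realTrace (NormedSpace.exp w.1) := by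
    intro w
    -- Taking `a = 0` and `b = (1 - α)⁻¹ w` in `hψtr` turns the left exponent into `L w + ψ 0`,
    -- since the two multiples of `ψ 0` add up to one.
    have hw : w = (1 - α) • (1 - α)⁻¹ • w := Subtype.ext (smul_inv_smul₀ hβ w.1).symm
    have h := hψtr 0 ((1 - α)⁻¹ • w)
    have h1 : (L w).1 = (1 - α) • (L ((1 - α)⁻¹ • w)).1 := by
      conv_lhs => rw [hw, map_smul]
      rfl
    have h2 : (ψ ((1 - α)⁻¹ • w)).1 = (L ((1 - α)⁻¹ • w)).1 + (ψ 0).1 :=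
      congrArg Subtype.val (hLψ _)
    have h3 : α • (ψ 0).1 + (1 - α) • (ψ ((1 - α)⁻¹ • w)).1 = (L w).1 + (ψ 0).1 := by
      rw [h1, h2]
      module
    have h4 : α • (0 : selfAdjoint (H →L[ℂ] H)).1 + (1 - α) • ((1 - α)⁻¹ • w).1 = w.1 := by
      rw [AddSubgroup.coe_zero, smul_zero, zero_add]
      exact smul_inv_smul₀ hβ w.1
    rw [h3, h4] at h
    exact h
  have hφL : ∀ A : PosDefOp H,
      (φ A).1 = NormedSpace.exp ((L (expEquiv.symm A)).1 + (ψ 0).1) := by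
    intro A
    conv_lhs => rw [← expEquiv.apply_symm_apply A, hψ, coe_expEquiv, hLψ]
    rfl
  have hexp : ∀ A : PosDefOp H, NormedSpace.exp (expEquiv.symm A).1 = A.1 := fun A =>
    congrArg Subtype.val (expEquiv.apply_symm_apply A)
  refine ⟨c, hc, ?_⟩
  rcases L.exists_unitary_or_antiunitary hL with ⟨U, hU⟩ | ⟨U, hUtr, hU⟩
  · left
    refine ⟨(Unitary.linearIsometryEquiv.symm U).1, (Unitary.linearIsometryEquiv.symm U).2,
      fun A => ?_⟩
    rw [hφL, exp_add_eq_smul_of_realTrace_exp L.surjective hU (exp_conjStarAlgEquiv U)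
      (realTrace_conjStarAlgEquiv U) hc htr, hexp,
      ← Unitary.conjStarAlgAut_symm_unitaryLinearIsometryEquiv, Unitary.conjStarAlgAut_apply]
  · right
    refine ⟨U, fun A => ?_⟩
    rw [hφL, exp_add_eq_smul_of_realTrace_exp L.surjective hU (exp_antiunitaryConj U)
      hUtr hc htr, hexp]
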